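/- Let $n,m\ge 0$ be integers. Let $Q_0,\dots,Q_m$ be real symmetric $n\times n$ matrices, $c_0,\dots,c_m\in\mathbb R^n$, $b\in\mathbb R^m$, and $\ell,u\in\mathbb R^n$ with $\ell\ge 0$. Write $\langle A,B\rangle=\sum_{i,j}a_{ij}b_{ij}$ and let $$(P)\quad \min\{\langle Q_0,xx^T\rangle+c_0^Tx \;:\; \langle Q_r,xx^T\rangle+c_r^Tx\le b_r\ (r=1,\dots,m),\ \ell_i\le x_i\le u_i\ (i=1,\dots,n)\},$$ whose feasible set is assumed to be non-empty. For $x\in\mathbb R^n$, a symmetric matrix $Y\in\mathbb R^{n\times n}$ and $i\le j$, the McCormick inequalities $h^t_{ij}(x,Y)\le 0$, $t=1,\dots,4$, are $$Y_{ij}-u_jx_i-\ell_ix_j+u_j\ell_i\le 0,\qquad Y_{ij}-u_ix_j-\ell_jx_i+u_i\ell_j\le 0,$$ $$-Y_{ij}+u_jx_i+u_ix_j-u_iu_j\le 0,\qquad -Y_{ij}+\ell_jx_i+\ell_ix_j-\ell_i\ell_j\le 0.$$ For $i<j<k$ the general triangle inequalities $h'^t_{ijk}(x,Y)\le 0$,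 $t=1,\dots,12$, are 1. $(\ell_k-u_k)Y_{ij}+(\ell_j-u_j)Y_{ik}-u_iY_{jk}+u_iu_kx_j+(u_ju_k-\ell_j\ell_k)x_i+u_iu_jx_k-u_iu_ju_k\le 0$ 2. $(\ell_k-u_k)Y_{ij}-u_jY_{ik}+(\ell_i-u_i)Y_{jk}+(u_iu_k-\ell_i\ell_k)x_j+u_ju_kx_i+u_iu_jx_k-u_iu_ju_k\le 0$ 3. $-u_kY_{ij}+(\ell_j-u_j)Y_{ik}+(\ell_i-u_i)Y_{jk}+u_iu_kx_j+u_ju_kx_i+(u_iu_j-\ell_i\ell_j)x_k-u_iu_ju_k\le 0$ 4. $(u_j-\ell_j)Y_{ik}+(\ell_k-u_k)Y_{ij}+u_iY_{jk}+(\ell_ju_k-u_j\ell_k)x_i-u_i\ell_kx_j-u_iu_jx_k+u_iu_j\ell_k\le 0$ 5. $u_jY_{ik}+(\ell_k-u_k)Y_{ij}+(u_i-\ell_i)Y_{jk}-u_j\ell_kx_i+(\ell_iu_k-u_i\ell_k)x_j-u_iu_jx_k+u_iu_j\ell_k\le 0$ 6. $(u_k-\ell_k)Y_{ij}+u_iY_{jk}+(\ell_j-u_j)Y_{ik}-u_iu_kx_j+(u_j\ell_k-\ell_ju_k)x_i-u_i\ell_jx_k+u_i\ell_ju_k\le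 0$ 7. $u_kY_{ij}+(u_i-\ell_i)Y_{jk}+(\ell_j-u_j)Y_{ik}-u_iu_kx_j-\ell_ju_kx_i+(\ell_iu_j-u_i\ell_j)x_k+u_i\ell_ju_k\le 0$ 8. $(u_k-\ell_k)Y_{ij}+(\ell_i-u_i)Y_{jk}+u_jY_{ik}+(u_i\ell_k-\ell_iu_k)x_j-u_ju_kx_i-\ell_iu_jx_k+\ell_iu_ju_k\le 0$ 9. $u_kY_{ij}+(\ell_i-u_i)Y_{jk}+(u_j-\ell_j)Y_{ik}-\ell_iu_kx_j-u_ju_kx_i+(u_i\ell_j-\ell_iu_j)x_k+\ell_iu_ju_k\le 0$ 10. $-u_iY_{jk}+(u_j-\ell_j)Y_{ik}+(u_k-\ell_k)Y_{ij}+u_i\ell_kx_j+(\ell_j\ell_k-u_ju_k)x_i+u_i\ell_jx_k-u_i\ell_j\ell_k\le 0$ 11. $(u_i-\ell_i)Y_{jk}-u_jY_{ik}+(u_k-\ell_k)Y_{ij}+(\ell_i\ell_k-u_iu_k)x_j+u_j\ell_kx_i+\ell_iu_jx_k-\ell_iu_j\ell_k\le 0$ 12. $-u_kY_{ij}+(u_i-\ell_i)Y_{jk}+(u_j-\ell_j)Y_{ik}+\ell_iu_kx_j+\ell_ju_kx_i+(\ell_i\ell_j-u_iu_j)x_k-\ell_i\ell_ju_k\le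 0$ For positive semidefinite matrices $S_0,\dots,S_m\in\mathbb R^{n\times n}$ let $v(P'_{S_0,\dots,S_m})$ be the optimal value of $$(P'_{S_0,\dots,S_m})\quad \min\ \langle S_0,xx^T\rangle+c_0^Tx+\langle Q_0-S_0,Y\rangle$$ over $x\in\mathbb R^n$ and $Y\in\mathbb R^{n\times n}$ subject to $\ell\le x\le u$; $\langle S_r,xx^T\rangle+c_r^Tx+\langle Q_r-S_r,Y\rangle\le b_r$ for $r=1,\dots,m$; the McCormick inequalities for all $i\le j$; the general triangle inequalities for all $i<j<k$; and $Y_{ji}=Y_{ij}$ for all $i<j$. Let $$v(OPT)=\sup_{S_0,\dots,S_m\succeq 0} v(P'_{S_0,\dots,S_m}).$$ Let $v(SDP)$ be the optimal value of the "Shor plus RLT plus Triangle" relaxation $$(SDP)\quad \min\ \langle Q_0,X\rangle+c_0^Tx$$ over $x\in\mathbb R^n$ and symmetric $X\in\mathbb R^{n\times n}$ subject to $\langle Q_r,X\rangle+c_r^Tx\le b_r$ for $r=1,\dots,m$; the inequalities $$X_{ii}-u_ix_i-\ell_ix_i+u_i\ell_i\le 0,\qquad -X_{ii}+2u_ix_i-u_i^2\le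 0,\qquad -X_{ii}+2\ell_ix_i-\ell_i^2\le 0$$ for all $i$; $\begin{pmatrix}1&x^T\\x&X\end{pmatrix}\succeq 0$; the McCormick inequalities $h^t_{ij}(x,X)\le 0$ for all $i<j$; and the general triangle inequalities $h'^t_{ijk}(x,X)\le 0$ for all $i<j<k$. (Optimal values of minimization problems are infima, in the extended reals.) Then $v(OPT)=v(SDP)$. -/

import Mathlib

open scoped Matrix

/-- The data of a quadratically constrained quadratic program `(P)` with `n` variables and `m`
constraints: minimize `⟨Q 0, x xᵀ⟩ + (c 0)ᵀ x` subject to `⟨Q r, x xᵀ⟩ + (c r)ᵀ x ≤ b r` for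
`r = 1, …, m`, and `l i ≤ x i ≤ u i`. The indices of `Q` and `c` run over `{0, 1, …, m}`;
the constraint with index `r : Fin m` of `b` is the one with index `r.succ` of `Q` and `c`. -/
structure QCQP (n m : ℕ) where
  Q : Fin (m + 1) → Matrix (Fin n) (Fin n) ℝ
  c : Fin (m + 1) → Fin n → ℝ
  b : Fin m → ℝ
  l : Fin n → ℝ
  u : Fin n → ℝ

namespace QCQP

variable {n m : ℕ}

/-- The inner product `⟨A, B⟩ = ∑ i, ∑ j, a i j * b i j` of matrices. -/
def frob (A B : Matrix (Fin n) (Fin n) ℝ) : ℝ := ∑ i, ∑ j, A i j * B i j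

/-- `x xᵀ`. -/
def outer (x : Fin n → ℝ) : Matrix (Fin n) (Fin n) ℝ := Matrix.vecMulVec x x

/-- The quadratic function `f_r(x) = ⟨Q r, x xᵀ⟩ + (c r)ᵀ x`. -/
def f (P : QCQP n m) (r : Fin (m + 1)) (x : Fin n → ℝ) : ℝ :=
  frob (P.Q r) (outer x) + P.c r ⬝ᵥ x

/-- The feasible set of `(P)`. -/
def feasible (P : QCQP n m) : Set (Fin n → ℝ) :=
  {x | (∀ r : Fin m, P.f r.succ x ≤ P.b r) ∧ ∀ i, P.l i ≤ x i ∧ x i ≤ P.u i}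

/-- The left-hand sides of the four McCormick inequalities `h^t_{ij}(x, Y) ≤ 0`. -/
def mcCormick (P : QCQP n m) (x : Fin n → ℝ) (Y : Matrix (Fin n) (Fin n) ℝ)
    (i j : Fin n) : Fin 4 → ℝ :=
  let l := P.l
  let u := P.u
  ![Y i j - u j * x i - l i * x j + u j * l i,
    Y i j - u i * x j - l j * x i + u i * l j,
    -Y i j + u j * x i + u i * x j - u i * u j,
    -Y i j + l j * x i + l i * x j - l i * l j]

/-- The left-hand sides of the twelve general triangle inequalities `h'^t_{ijk}(x, Y) ≤ 0`. -/
def triangle (P : QCQP n m) (x : Fin n → ℝ) (Y : Matrix (Fin n) (Fin n) ℝ)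
    (i j k : Fin n) : Fin 12 → ℝ :=
  let l := P.l
  let u := P.u
  ![(l k - u k) * Y i j + (l j - u j) * Y i k - u i * Y j k
      + u i * u k * x j + (u j * u k - l j * l k) * x i + u i * u j * x k - u i * u j * u k,
    (l k - u k) * Y i j - u j * Y i k + (l i - u i) * Y j k
      + (u i * u k - l i * l k) * x j + u j * u k * x i + u i * u j * x k - u i * u j * u k,
    -u k * Y i j + (l j - u j) * Y i k + (l i - u i) * Y j k
      + u i * u k * x j + u j * u k * x i + (u i * u j - l i * l j) * x k - u i * u j * u k,
    (u j - l j) * Y i k + (l k - u k) * Y i j + u i * Y j k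
      + (l j * u k - u j * l k) * x i - u i * l k * x j - u i * u j * x k + u i * u j * l k,
    u j * Y i k + (l k - u k) * Y i j + (u i - l i) * Y j k
      - u j * l k * x i + (l i * u k - u i * l k) * x j - u i * u j * x k + u i * u j * l k,
    (u k - l k) * Y i j + u i * Y j k + (l j - u j) * Y i k
      - u i * u k * x j + (u j * l k - l j * u k) * x i - u i * l j * x k + u i * l j * u k,
    u k * Y i j + (u i - l i) * Y j k + (l j - u j) * Y i k
      - u i * u k * x j - l j * u k * x i + (l i * u j - u i * l j) * x k + u i * l j * u k,
    (u k - l k) * Y i j + (l i - u i) * Y j k + u j * Y i k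
      + (u i * l k - l i * u k) * x j - u j * u k * x i - l i * u j * x k + l i * u j * u k,
    u k * Y i j + (l i - u i) * Y j k + (u j - l j) * Y i k
      - l i * u k * x j - u j * u k * x i + (u i * l j - l i * u j) * x k + l i * u j * u k,
    -u i * Y j k + (u j - l j) * Y i k + (u k - l k) * Y i j
      + u i * l k * x j + (l j * l k - u j * u k) * x i + u i * l j * x k - u i * l j * l k,
    (u i - l i) * Y j k - u j * Y i k + (u k - l k) * Y i j
      + (l i * l k - u i * u k) * x j + u j * l k * x i + l i * u j * x k - l i * u j * l k,
    -u k * Y i j + (u i - l i) * Y j k + (u j - l j) * Y i k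
      + l i * u k * x j + l j * u k * x i + (l i * l j - u i * u j) * x k - l i * l j * u k]

/-- The convexified function `f_{r,S}(x, Y) = ⟨S, x xᵀ⟩ + (c r)ᵀ x + ⟨Q r - S, Y⟩`. -/
def convexified (P : QCQP n m) (r : Fin (m + 1)) (S : Matrix (Fin n) (Fin n) ℝ)
    (x : Fin n → ℝ) (Y : Matrix (Fin n) (Fin n) ℝ) : ℝ :=
  frob S (outer x) + P.c r ⬝ᵥ x + frob (P.Q r - S) Y

/-- The feasible set of the strengthened convex relaxation `(P'_{S_0, …, S_m})`. -/
def relaxFeasible (P : QCQP n m) (S : Fin (m + 1) → Matrix (Fin n) (Fin n) ℝ) :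
    Set ((Fin n → ℝ) × Matrix (Fin n) (Fin n) ℝ) :=
  {p | (∀ i, P.l i ≤ p.1 i ∧ p.1 i ≤ P.u i) ∧
    (∀ r : Fin m, P.convexified r.succ (S r.succ) p.1 p.2 ≤ P.b r) ∧
    (∀ i j, i ≤ j → ∀ t, P.mcCormick p.1 p.2 i j t ≤ 0) ∧
    (∀ i j k, i < j → j < k → ∀ t, P.triangle p.1 p.2 i j k t ≤ 0) ∧
    (∀ i j, i < j → p.2 j i = p.2 i j)}

/-- The optimal value `v(P'_{S_0, …, S_m})`, in the extended reals. -/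
noncomputable def vRelax (P : QCQP n m) (S : Fin (m + 1) → Matrix (Fin n) (Fin n) ℝ) : EReal :=
  ⨅ p ∈ P.relaxFeasible S, ((P.convexified 0 (S 0) p.1 p.2 : ℝ) : EReal)

/-- The optimal value `v(OPT)`: the supremum of `v(P'_{S_0, …, S_m})` over all tuples of positive
semidefinite matrices. -/
noncomputable def vOPT (P : QCQP n m) : EReal :=
  ⨆ S ∈ {S : Fin (m + 1) → Matrix (Fin n) (Fin n) ℝ | ∀ r, (S r).PosSemidef}, P.vRelax S

/-- The block matrix with rows `(1, xᵀ)` and `(x, X)`. -/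
def shorMatrix (x : Fin n → ℝ) (X : Matrix (Fin n) (Fin n) ℝ) :
    Matrix (Unit ⊕ Fin n) (Unit ⊕ Fin n) ℝ :=
  Matrix.fromBlocks 1 (Matrix.replicateRow Unit x) (Matrix.replicateCol Unit x) X

/-- The set `W` of the "Shor plus diagonal RLT" constraints. -/
def W (P : QCQP n m) : Set ((Fin n → ℝ) × Matrix (Fin n) (Fin n) ℝ) :=
  {p | (∀ r : Fin m, frob (P.Q r.succ) p.2 + P.c r.succ ⬝ᵥ p.1 ≤ P.b r) ∧
    (∀ i, p.2 i i - P.u i * p.1 i - P.l i * p.1 i + P.u i * P.l i ≤ 0) ∧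
    (∀ i, -p.2 i i + 2 * P.u i * p.1 i - P.u i ^ 2 ≤ 0) ∧
    (∀ i, -p.2 i i + 2 * P.l i * p.1 i - P.l i ^ 2 ≤ 0) ∧
    (shorMatrix p.1 p.2).PosSemidef ∧
    p.2.IsSymm}

/-- The feasible set of the "Shor plus RLT plus Triangle" semidefinite relaxation `(SDP)`. -/
def sdpFeasible (P : QCQP n m) : Set ((Fin n → ℝ) × Matrix (Fin n) (Fin n) ℝ) :=
  {p | p ∈ P.W ∧
    (∀ i j, i < j → ∀ t, P.mcCormick p.1 p.2 i j t ≤ 0) ∧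
    (∀ i j k, i < j → j < k → ∀ t, P.triangle p.1 p.2 i j k t ≤ 0)}

/-- The optimal value `v(SDP)`, in the extended reals. -/
noncomputable def vSDP (P : QCQP n m) : EReal :=
  ⨅ p ∈ P.sdpFeasible, ((frob (P.Q 0) p.2 + P.c 0 ⬝ᵥ p.1 : ℝ) : EReal)

end QCQP

/-!
The convexified function equals `⟨Q, Y⟩ + cᵀx - ⟨S, Y - xxᵀ⟩`, so a matrix `S ⪰ 0` acts as a
Lagrange multiplier for the constraint `Y - xxᵀ ⪰ 0`, which is the Shor constraint by Schur
complementation. The cone of positive semidefinite matrices being self-dual, the supremum of the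
convexified objective over `S ⪰ 0` is the objective of the semidefinite program where the constraint
holds and `+∞` elsewhere; hence `v(SDP)` is an inf-sup value and weak duality gives
`v(OPT) ≤ v(SDP)`. For the converse it suffices to convexify the objective only, with `S_r = 0` for
`r ≥ 1`: the McCormick inequalities make the remaining feasible set compact, and Sion's minimax
theorem exchanges the infimum and the supremum without any constraint qualification.
-/

theorem iInf_iSup_coe_ereal_eq_iSup_iInf {E F : Type*}
    [TopologicalSpace E] [AddCommGroup E] [Module ℝ E] [IsTopologicalAddGroup E]
    [ContinuousSMul ℝ E] [TopologicalSpace F] [AddCommGroup F] [Module ℝ F]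
    [IsTopologicalAddGroup F] [ContinuousSMul ℝ F] {K : Set E} {D : Set F} {f : E → F → ℝ}
    (hK : IsCompact K) (hKc : Convex ℝ K) (hD : D.Nonempty) (hDc : Convex ℝ D)
    (hlsc : ∀ y ∈ D, LowerSemicontinuousOn (f · y) K) (hconv : ∀ y ∈ D, QuasiconvexOn ℝ K (f · y))
    (husc : ∀ x ∈ K, UpperSemicontinuousOn (f x) D) (hconc : ∀ x ∈ K, QuasiconcaveOn ℝ D (f x)) :
    ⨅ x ∈ K, ⨆ y ∈ D, (f x y : EReal) = ⨆ y ∈ D, ⨅ x ∈ K, (f x y : EReal) := by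
  have hmono : Monotone Real.toEReal := EReal.coe_strictMono.monotone
  rcases K.eq_empty_or_nonempty with rfl | hne
  · simp [biSup_const hD]
  · exact Sion.minimax' hne hKc hK
      (fun y hy => continuous_coe_real_ereal.comp_lowerSemicontinuousOn (hlsc y hy) hmono)
      (fun y hy => (hconv y hy).monotone_comp (g := Real.toEReal) hmono) hDc
      (fun x hx => continuous_coe_real_ereal.comp_upperSemicontinuousOn (husc x hx) hmono)
      (fun x hx => (hconc x hx).monotone_comp (g := Real.toEReal) hmono)

namespace QCQP

variable {n m : ℕ}

section Frobenius

variable (A B C : Matrix (Fin n) (Fin n) ℝ)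

theorem frob_eq_trace : frob A B = (A * Bᵀ).trace := by
  simp [frob, Matrix.trace, Matrix.mul_apply]

theorem frob_add_left : frob (A + B) C = frob A C + frob B C := by
  simp [frob_eq_trace, Matrix.add_mul]

theorem frob_add_right : frob A (B + C) = frob A B + frob A C := by
  simp [frob_eq_trace, Matrix.mul_add]

theorem frob_sub_left : frob (A - B) C = frob A C - frob B C := by
  simp [frob_eq_trace, Matrix.sub_mul]

theorem frob_sub_right : frob A (B - C) = frob A B - frob A C := by
  simp [frob_eq_trace, Matrix.mul_sub]

theorem frob_smul_left (a : ℝ) : frob (a • A) B = a * frob A B := by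
  simp [frob_eq_trace]

theorem frob_smul_right (a : ℝ) : frob A (a • B) = a * frob A B := by
  simp [frob_eq_trace]

theorem frob_zero_left : frob 0 A = 0 := by
  simp [frob_eq_trace]

theorem frob_comm : frob A B = frob B A := by
  simp only [frob, mul_comm]

theorem frob_outer_left (v : Fin n → ℝ) : frob (outer v) A = v ⬝ᵥ A *ᵥ v := by
  simp only [frob, outer, Matrix.vecMulVec_apply, dotProduct, Matrix.mulVec, Finset.mul_sum,
    mul_assoc, mul_comm (A _ _)]

end Frobenius

section PosSemidef

variable {A B S : Matrix (Fin n) (Fin n) ℝ}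

theorem convex_setOf_posSemidef : Convex ℝ {A : Matrix (Fin n) (Fin n) ℝ | A.PosSemidef} :=
  fun _ hA _ hB _ _ ha hb _ => (hA.smul ha).add (hB.smul hb)

theorem posSemidef_outer (v : Fin n → ℝ) : (outer v).PosSemidef := by
  simpa [outer] using Matrix.posSemidef_vecMulVec_self_star v

-- `⟨A, B⟩ = 1ᵀ(A ∘ B)1`, and the Hadamard product `A ∘ B` is positive semidefinite.
theorem frob_nonneg (hA : A.PosSemidef) (hB : B.PosSemidef) : 0 ≤ frob A B := by
  simpa [frob, dotProduct, Matrix.mulVec] using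
    (hA.hadamard hB).dotProduct_mulVec_nonneg (1 : Fin n → ℝ)

theorem posSemidef_iff_forall_frob_nonneg (hA : A.IsSymm) :
    A.PosSemidef ↔ ∀ S : Matrix (Fin n) (Fin n) ℝ, S.PosSemidef → 0 ≤ frob S A := by
  refine ⟨fun h S hS => frob_nonneg hS h, fun h => ?_⟩
  have hherm : A.IsHermitian := by
    rwa [Matrix.IsHermitian, Matrix.conjTranspose_eq_transpose_of_trivial]
  refine .of_dotProduct_mulVec_nonneg hherm fun v => ?_
  rw [star_trivial, ← frob_outer_left]
  exact h _ (posSemidef_outer v)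

theorem shorMatrix_posSemidef_iff (x : Fin n → ℝ) (X : Matrix (Fin n) (Fin n) ℝ) :
    (shorMatrix x X).PosSemidef ↔ (X - outer x).PosSemidef := by
  let _ : Invertible (1 : Matrix Unit Unit ℝ) := invertibleOne
  have hrow : (Matrix.replicateRow Unit x)ᴴ = Matrix.replicateCol Unit x := by
    ext; simp
  have hmul : Matrix.replicateCol Unit x * Matrix.replicateRow Unit x = outer x := by
    rw [outer, Matrix.vecMulVec_eq Unit]
  have schur := Matrix.PosDef.fromBlocks₁₁ (Matrix.replicateRow Unit x) X
    (Matrix.PosDef.one (n := Unit) (R := ℝ))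
  rwa [hrow, inv_one, Matrix.mul_one, hmul] at schur

theorem convexOn_frob_outer (hS : S.PosSemidef) :
    ConvexOn ℝ Set.univ fun x => frob S (outer x) := by
  refine ⟨convex_univ, fun x _ y _ a b ha hb hab => ?_⟩
  have hxy : 0 ≤ a * b * frob S (outer (x - y)) :=
    mul_nonneg (mul_nonneg ha hb) (frob_nonneg hS (posSemidef_outer _))
  have gap : a * frob S (outer x) + b * frob S (outer y) - frob S (outer (a • x + b • y)) =
      a * b * frob S (outer (x - y)) := by
    obtain rfl := eq_sub_of_add_eq' hab
    simp only [frob_comm S, frob_outer_left, Matrix.mulVec_add, Matrix.mulVec_sub,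
      Matrix.mulVec_smul, dotProduct_add, add_dotProduct, dotProduct_sub, sub_dotProduct,
      dotProduct_smul, smul_dotProduct, smul_eq_mul]
    ring
  simp only [smul_eq_mul]
  linarith

end PosSemidef

section Convexified

variable (P : QCQP n m) (r : Fin (m + 1)) {S : Matrix (Fin n) (Fin n) ℝ}
  {x : Fin n → ℝ} {Y : Matrix (Fin n) (Fin n) ℝ}

theorem convexified_zero (x : Fin n → ℝ) (Y : Matrix (Fin n) (Fin n) ℝ) :
    P.convexified r 0 x Y = frob (P.Q r) Y + P.c r ⬝ᵥ x := by
  rw [convexified, frob_zero_left, sub_zero, zero_add, add_comm]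

theorem convexified_eq_sub (S : Matrix (Fin n) (Fin n) ℝ) (x : Fin n → ℝ)
    (Y : Matrix (Fin n) (Fin n) ℝ) :
    P.convexified r S x Y = P.convexified r 0 x Y - frob S (Y - outer x) := by
  rw [convexified_zero, convexified, frob_sub_left, frob_sub_right]
  ring

theorem convexified_le_convexified_zero (hS : S.PosSemidef) (hY : (Y - outer x).PosSemidef) :
    P.convexified r S x Y ≤ P.convexified r 0 x Y := by
  rw [convexified_eq_sub]
  exact sub_le_self _ (frob_nonneg hS hY)

theorem convexOn_convexified (hS : S.PosSemidef) :
    ConvexOn ℝ Set.univ fun p : (Fin n → ℝ) × Matrix (Fin n) (Fin n) ℝ =>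
      P.convexified r S p.1 p.2 := by
  refine ⟨convex_univ, fun p _ q _ a b ha hb hab => ?_⟩
  have hquad := (convexOn_frob_outer hS).2 (Set.mem_univ p.1) (Set.mem_univ q.1) ha hb hab
  simp only [convexified, Prod.fst_add, Prod.snd_add, Prod.smul_fst, Prod.smul_snd,
    frob_add_right, frob_smul_right, dotProduct_add, dotProduct_smul, smul_eq_mul] at hquad ⊢
  linarith

theorem concaveOn_convexified_matrix (x : Fin n → ℝ) (Y : Matrix (Fin n) (Fin n) ℝ) :
    ConcaveOn ℝ Set.univ fun S => P.convexified r S x Y := by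
  refine ⟨convex_univ, fun A _ B _ a b _ _ hab => le_of_eq ?_⟩
  obtain rfl := eq_sub_of_add_eq' hab
  beta_reduce
  rw [P.convexified_eq_sub r A, P.convexified_eq_sub r B, P.convexified_eq_sub r (_ + _),
    frob_add_left, frob_smul_left, frob_smul_left, smul_eq_mul, smul_eq_mul]
  ring

theorem continuous_convexified :
    Continuous fun q : Matrix (Fin n) (Fin n) ℝ × (Fin n → ℝ) × Matrix (Fin n) (Fin n) ℝ =>
      P.convexified r q.1 q.2.1 q.2.2 := by
  simp only [convexified, frob, outer, Matrix.vecMulVec_apply, dotProduct, Matrix.sub_apply]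
  fun_prop

theorem iSup_convexified_of_posSemidef (h : (Y - outer x).PosSemidef) :
    ⨆ S ∈ {S : Matrix (Fin n) (Fin n) ℝ | S.PosSemidef}, (P.convexified r S x Y : EReal) =
      P.convexified r 0 x Y :=
  le_antisymm
    (iSup₂_le fun _ hS => EReal.coe_le_coe_iff.mpr (P.convexified_le_convexified_zero r hS h))
    (le_iSup₂_of_le 0 .zero le_rfl)

-- Multiples of a matrix `S ⪰ 0` with `⟨S, Y - xxᵀ⟩ < 0` drive the supremum to `+∞`.
theorem iSup_convexified_of_not_posSemidef (hY : Y.IsSymm) (h : ¬(Y - outer x).PosSemidef) :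
    ⨆ S ∈ {S : Matrix (Fin n) (Fin n) ℝ | S.PosSemidef}, (P.convexified r S x Y : EReal) = ⊤ := by
  have hsymm : (Y - outer x).IsSymm := hY.sub (Matrix.transpose_vecMulVec x x)
  obtain ⟨S, hS, hneg⟩ : ∃ S : Matrix (Fin n) (Fin n) ℝ,
      S.PosSemidef ∧ frob S (Y - outer x) < 0 := by
    simpa [posSemidef_iff_forall_frob_nonneg hsymm] using h
  refine (EReal.eq_top_iff_forall_lt _).mpr fun y => ?_
  obtain ⟨k, hk⟩ := exists_lt_nsmul (neg_pos.mpr hneg) (y - P.convexified r 0 x Y)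
  have hlt : y < P.convexified r ((k : ℝ) • S) x Y := by
    rw [nsmul_eq_mul] at hk
    rw [convexified_eq_sub, frob_smul_left]
    linarith
  exact (EReal.coe_lt_coe_iff.mpr hlt).trans_le
    (le_iSup₂_of_le _ (hS.smul k.cast_nonneg) le_rfl)

end Convexified

section Relaxation

variable (P : QCQP n m) {S : Fin (m + 1) → Matrix (Fin n) (Fin n) ℝ}

theorem convexOn_mcCormick (i j : Fin n) (t : Fin 4) :
    ConvexOn ℝ Set.univ fun p : (Fin n → ℝ) × Matrix (Fin n) (Fin n) ℝ =>
      P.mcCormick p.1 p.2 i j t := by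
  refine ⟨convex_univ, fun p _ q _ a b _ _ hab => le_of_eq ?_⟩
  obtain rfl := eq_sub_of_add_eq' hab
  fin_cases t <;> simp [mcCormick] <;> ring

theorem convexOn_triangle (i j k : Fin n) (t : Fin 12) :
    ConvexOn ℝ Set.univ fun p : (Fin n → ℝ) × Matrix (Fin n) (Fin n) ℝ =>
      P.triangle p.1 p.2 i j k t := by
  refine ⟨convex_univ, fun p _ q _ a b _ _ hab => le_of_eq ?_⟩
  obtain rfl := eq_sub_of_add_eq' hab
  fin_cases t <;> simp [triangle] <;> ring

theorem continuous_mcCormick (i j : Fin n) (t : Fin 4) :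
    Continuous fun p : (Fin n → ℝ) × Matrix (Fin n) (Fin n) ℝ => P.mcCormick p.1 p.2 i j t := by
  fin_cases t <;>
    simp only [mcCormick, Fin.zero_eta, Fin.mk_one, Fin.reduceFinMk, Matrix.cons_val] <;>
    fun_prop

theorem continuous_triangle (i j k : Fin n) (t : Fin 12) :
    Continuous fun p : (Fin n → ℝ) × Matrix (Fin n) (Fin n) ℝ =>
      P.triangle p.1 p.2 i j k t := by
  fin_cases t <;>
    simp only [triangle, Fin.zero_eta, Fin.mk_one, Fin.reduceFinMk, Matrix.cons_val] <;>
    fun_prop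

theorem mcCormick_self_nonpos_iff (x : Fin n → ℝ) (Y : Matrix (Fin n) (Fin n) ℝ) (i : Fin n) :
    (∀ t, P.mcCormick x Y i i t ≤ 0) ↔
      Y i i - P.u i * x i - P.l i * x i + P.u i * P.l i ≤ 0 ∧
      -Y i i + 2 * P.u i * x i - P.u i ^ 2 ≤ 0 ∧
      -Y i i + 2 * P.l i * x i - P.l i ^ 2 ≤ 0 := by
  constructor
  · intro h
    have h₀ := h 0
    have h₂ := h 2
    have h₃ := h 3
    simp only [mcCormick, Matrix.cons_val] at h₀ h₂ h₃
    refine ⟨?_, ?_, ?_⟩ <;> linarith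
  · rintro ⟨h₀, h₂, h₃⟩ t
    fin_cases t <;>
      simp only [mcCormick, Fin.zero_eta, Fin.mk_one, Fin.reduceFinMk, Matrix.cons_val] <;>
      linarith

theorem isSymm_of_mem_relaxFeasible {p : (Fin n → ℝ) × Matrix (Fin n) (Fin n) ℝ}
    (hp : p ∈ P.relaxFeasible S) : p.2.IsSymm := by
  have hsymm := hp.2.2.2.2
  refine .ext fun i j => ?_
  rcases lt_trichotomy i j with hij | rfl | hij
  · exact hsymm i j hij
  · rfl
  · exact (hsymm j i hij).symm

theorem convex_relaxFeasible (hS : ∀ r : Fin m, (S r.succ).PosSemidef) :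
    Convex ℝ (P.relaxFeasible S) := by
  rintro p ⟨hbox, hcon, hmc, htri, hsymm⟩ q ⟨hbox', hcon', hmc', htri', hsymm'⟩ a b ha hb hab
  have sublevel {g : (Fin n → ℝ) × Matrix (Fin n) (Fin n) ℝ → ℝ} {c : ℝ}
      (hg : ConvexOn ℝ Set.univ g) (hp : g p ≤ c) (hq : g q ≤ c) : g (a • p + b • q) ≤ c :=
    (hg.convex_le c ⟨trivial, hp⟩ ⟨trivial, hq⟩ ha hb hab).2
  refine ⟨fun i => convex_Icc _ _ (hbox i) (hbox' i) ha hb hab,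
    fun r => sublevel (P.convexOn_convexified _ (hS r)) (hcon r) (hcon' r),
    fun i j hij t => sublevel (P.convexOn_mcCormick i j t) (hmc i j hij t) (hmc' i j hij t),
    fun i j k hij hjk t => sublevel (P.convexOn_triangle i j k t)
      (htri i j k hij hjk t) (htri' i j k hij hjk t),
    fun i j hij => ?_⟩
  simp [hsymm i j hij, hsymm' i j hij]

theorem isClosed_relaxFeasible (S : Fin (m + 1) → Matrix (Fin n) (Fin n) ℝ) :
    IsClosed (P.relaxFeasible S) := by
  simp only [relaxFeasible, Set.ofPred_and, Set.ofPred_forall]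
  refine .inter (isClosed_iInter fun i => .inter ?_ ?_) <| .inter (isClosed_iInter fun r => ?_) <|
    .inter (isClosed_iInter fun i => isClosed_iInter fun j => isClosed_iInter fun _ =>
      isClosed_iInter fun t => ?_) <|
    .inter (isClosed_iInter fun i => isClosed_iInter fun j => isClosed_iInter fun k =>
      isClosed_iInter fun _ => isClosed_iInter fun _ => isClosed_iInter fun t => ?_) <|
    isClosed_iInter fun i => isClosed_iInter fun j => isClosed_iInter fun _ => ?_
  · exact isClosed_le (by fun_prop) (by fun_prop)
  · exact isClosed_le (by fun_prop) (by fun_prop)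
  · exact isClosed_le ((P.continuous_convexified r.succ).comp (.prodMk_right (S r.succ)))
      continuous_const
  · exact isClosed_le (P.continuous_mcCormick i j t) continuous_const
  · exact isClosed_le (P.continuous_triangle i j k t) continuous_const
  · exact isClosed_eq (by fun_prop) (by fun_prop)

theorem abs_sub_outer_le_of_mem_relaxFeasible {p : (Fin n → ℝ) × Matrix (Fin n) (Fin n) ℝ}
    (hp : p ∈ P.relaxFeasible S) (i j : Fin n) :
    |(p.2 - outer p.1) i j| ≤ (P.u i - P.l i) * (P.u j - P.l j) := by
  wlog hij : i ≤ j generalizing i j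
  · have hsymm : (p.2 - outer p.1).IsSymm :=
      (P.isSymm_of_mem_relaxFeasible hp).sub (Matrix.transpose_vecMulVec _ _)
    rw [← hsymm.apply, mul_comm]
    exact this j i (le_of_not_ge hij)
  obtain ⟨hbox, -, hmc, -, -⟩ := hp
  obtain ⟨hli, hui⟩ := hbox i
  obtain ⟨hlj, huj⟩ := hbox j
  have hupper := hmc i j hij 0
  have hlower := hmc i j hij 3
  simp only [mcCormick, Matrix.cons_val] at hupper hlower
  rw [Matrix.sub_apply, outer, Matrix.vecMulVec_apply, abs_le']
  constructor
  · calc p.2 i j - p.1 i * p.1 j ≤ (p.1 i - P.l i) * (P.u j - p.1 j) := by linarith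
      _ ≤ (P.u i - P.l i) * (P.u j - P.l j) := by gcongr; linarith
  · calc -(p.2 i j - p.1 i * p.1 j) ≤ (p.1 i - P.l i) * (p.1 j - P.l j) := by linarith
      _ ≤ (P.u i - P.l i) * (P.u j - P.l j) := by gcongr; linarith

theorem isCompact_relaxFeasible (S : Fin (m + 1) → Matrix (Fin n) (Fin n) ℝ) :
    IsCompact (P.relaxFeasible S) := by
  let gaps : Set (Matrix (Fin n) (Fin n) ℝ) := Set.univ.pi fun i => Set.univ.pi fun j =>
    Set.Icc (-((P.u i - P.l i) * (P.u j - P.l j))) ((P.u i - P.l i) * (P.u j - P.l j))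
  have hgaps : IsCompact gaps :=
    isCompact_univ_pi fun _ => isCompact_univ_pi fun _ => isCompact_Icc
  have hcont : Continuous fun q : (Fin n → ℝ) × Matrix (Fin n) (Fin n) ℝ =>
      (q.1, q.2 + outer q.1) := by
    unfold outer
    fun_prop
  refine ((isCompact_Icc (a := P.l) (b := P.u)).prod hgaps |>.image hcont).of_isClosed_subset
    (P.isClosed_relaxFeasible S) fun p hp => ?_
  exact ⟨(p.1, p.2 - outer p.1), ⟨⟨fun i => (hp.1 i).1, fun i => (hp.1 i).2⟩,
    fun i _ j _ => abs_le.mp (P.abs_sub_outer_le_of_mem_relaxFeasible hp i j)⟩, by simp⟩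

end Relaxation

section Duality

variable (P : QCQP n m) {S : Fin (m + 1) → Matrix (Fin n) (Fin n) ℝ}

-- `x i ^ 2 ≤ Y i i ≤ (u i + l i) * x i - u i * l i` says that `(x i - l i) * (x i - u i) ≤ 0`.
theorem mem_Icc_of_posSemidef_sub_outer {x : Fin n → ℝ} {Y : Matrix (Fin n) (Fin n) ℝ} {i : Fin n}
    (hlu : P.l i ≤ P.u i) (h : (Y - outer x).PosSemidef)
    (hdiag : Y i i - P.u i * x i - P.l i * x i + P.u i * P.l i ≤ 0) :
    x i ∈ Set.Icc (P.l i) (P.u i) := by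
  have hsq : 0 ≤ Y i i - x i * x i := by
    simpa [outer, Matrix.vecMulVec_apply] using h.diag_nonneg (i := i)
  rw [Set.mem_Icc, ← sub_mul_sub_nonpos_iff _ hlu]
  linarith

theorem mem_sdpFeasible_iff (hlu : ∀ i, P.l i ≤ P.u i)
    (p : (Fin n → ℝ) × Matrix (Fin n) (Fin n) ℝ) :
    p ∈ P.sdpFeasible ↔ p ∈ P.relaxFeasible 0 ∧ (p.2 - outer p.1).PosSemidef := by
  constructor
  · rintro ⟨⟨hcon, hd₁, hd₂, hd₃, hshor, hsymm⟩, hmc, htri⟩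
    have hpsd := (shorMatrix_posSemidef_iff _ _).mp hshor
    refine ⟨⟨fun i => P.mem_Icc_of_posSemidef_sub_outer (hlu i) hpsd (hd₁ i),
      fun r => (P.convexified_zero _ _ _).trans_le (hcon r), fun i j hij => ?_, htri,
      fun i j _ => hsymm.apply i j⟩, hpsd⟩
    rcases hij.lt_or_eq with hij | rfl
    · exact hmc i j hij
    · exact (P.mcCormick_self_nonpos_iff _ _ i).mpr ⟨hd₁ i, hd₂ i, hd₃ i⟩
  · rintro ⟨hp, hpsd⟩
    have hsymm := P.isSymm_of_mem_relaxFeasible hp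
    obtain ⟨-, hcon, hmc, htri, -⟩ := hp
    have hdiag i := (P.mcCormick_self_nonpos_iff _ _ i).mp (hmc i i le_rfl)
    exact ⟨⟨fun r => (P.convexified_zero _ _ _).symm.trans_le (hcon r), fun i => (hdiag i).1,
      fun i => (hdiag i).2.1, fun i => (hdiag i).2.2, (shorMatrix_posSemidef_iff _ _).mpr hpsd,
      hsymm⟩, fun i j hij => hmc i j hij.le, htri⟩

theorem sdpFeasible_subset_relaxFeasible (hlu : ∀ i, P.l i ≤ P.u i)
    (hS : ∀ r : Fin m, (S r.succ).PosSemidef) : P.sdpFeasible ⊆ P.relaxFeasible S := by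
  intro p hp
  obtain ⟨⟨hbox, hcon, hrest⟩, hpsd⟩ := (P.mem_sdpFeasible_iff hlu p).mp hp
  exact ⟨hbox, fun r => (P.convexified_le_convexified_zero _ (hS r) hpsd).trans (hcon r), hrest⟩

theorem vOPT_le_vSDP (hlu : ∀ i, P.l i ≤ P.u i) : P.vOPT ≤ P.vSDP := by
  refine iSup₂_le fun S hS => le_iInf₂ fun p hp => ?_
  have hpsd := ((P.mem_sdpFeasible_iff hlu p).mp hp).2
  calc P.vRelax S ≤ P.convexified 0 (S 0) p.1 p.2 :=
        iInf₂_le p (P.sdpFeasible_subset_relaxFeasible hlu (fun r => hS r.succ) hp)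
    _ ≤ P.convexified 0 0 p.1 p.2 :=
        EReal.coe_le_coe_iff.mpr (P.convexified_le_convexified_zero 0 (hS 0) hpsd)
    _ = ↑(frob (P.Q 0) p.2 + P.c 0 ⬝ᵥ p.1) := by rw [convexified_zero]

theorem vSDP_le_iInf_iSup_convexified (hlu : ∀ i, P.l i ≤ P.u i) :
    P.vSDP ≤ ⨅ p ∈ P.relaxFeasible 0, ⨆ S ∈ {S : Matrix (Fin n) (Fin n) ℝ | S.PosSemidef},
      (P.convexified 0 S p.1 p.2 : EReal) := by
  refine le_iInf₂ fun p hp => ?_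
  by_cases hpsd : (p.2 - outer p.1).PosSemidef
  · rw [P.iSup_convexified_of_posSemidef 0 hpsd, convexified_zero]
    exact iInf₂_le p ((P.mem_sdpFeasible_iff hlu p).mpr ⟨hp, hpsd⟩)
  · rw [P.iSup_convexified_of_not_posSemidef 0 (P.isSymm_of_mem_relaxFeasible hp) hpsd]
    exact le_top

theorem iInf_iSup_convexified_eq_iSup_iInf (hS : ∀ r : Fin m, (S r.succ).PosSemidef) :
    ⨅ p ∈ P.relaxFeasible S, ⨆ T ∈ {T : Matrix (Fin n) (Fin n) ℝ | T.PosSemidef},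
      (P.convexified 0 T p.1 p.2 : EReal) =
    ⨆ T ∈ {T : Matrix (Fin n) (Fin n) ℝ | T.PosSemidef}, ⨅ p ∈ P.relaxFeasible S,
      (P.convexified 0 T p.1 p.2 : EReal) := by
  have hK := P.convex_relaxFeasible hS
  have hcont := P.continuous_convexified 0
  exact iInf_iSup_coe_ereal_eq_iSup_iInf (P.isCompact_relaxFeasible S) hK ⟨0, .zero⟩
    convex_setOf_posSemidef
    (fun T _ => (hcont.comp (.prodMk_right T)).lowerSemicontinuous.lowerSemicontinuousOn _)
    (fun T hT => ((P.convexOn_convexified 0 hT).subset (Set.subset_univ _) hK).quasiconvexOn)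
    (fun p _ => (hcont.comp (.prodMk_left p)).upperSemicontinuous.upperSemicontinuousOn _)
    (fun p _ => ((P.concaveOn_convexified_matrix 0 p.1 p.2).subset (Set.subset_univ _)
      convex_setOf_posSemidef).quasiconcaveOn)

theorem iSup_iInf_convexified_le_vOPT :
    ⨆ T ∈ {T : Matrix (Fin n) (Fin n) ℝ | T.PosSemidef}, ⨅ p ∈ P.relaxFeasible 0,
      (P.convexified 0 T p.1 p.2 : EReal) ≤ P.vOPT :=
  iSup₂_le fun T hT => le_iSup₂_of_le (f := fun S _ => P.vRelax S)
    (Fin.cons T fun _ => 0) (Fin.cases hT fun _ => .zero) le_rfl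

end Duality

end QCQP

theorem theorem1_general {n m : ℕ} (P : QCQP n m) (hlu : ∀ i, P.l i ≤ P.u i) :
    P.vOPT = P.vSDP := by
  refine le_antisymm (P.vOPT_le_vSDP hlu) ?_
  calc P.vSDP
      ≤ ⨅ p ∈ P.relaxFeasible 0, ⨆ S ∈ {S : Matrix (Fin n) (Fin n) ℝ | S.PosSemidef},
          (P.convexified 0 S p.1 p.2 : EReal) := P.vSDP_le_iInf_iSup_convexified hlu
    _ = ⨆ S ∈ {S : Matrix (Fin n) (Fin n) ℝ | S.PosSemidef}, ⨅ p ∈ P.relaxFeasible 0,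
          (P.convexified 0 S p.1 p.2 : EReal) :=
        P.iInf_iSup_convexified_eq_iSup_iInf fun _ => .zero
    _ ≤ P.vOPT := P.iSup_iInf_convexified_le_vOPT

theorem theorem1 {n m : ℕ} (P : QCQP n m)
    (hQ : ∀ r, (P.Q r).IsSymm)
    (hl : ∀ i, 0 ≤ P.l i)
    (hP : P.feasible.Nonempty) :
    P.vOPT = P.vSDP := by
  obtain ⟨x, -, hx⟩ := hP
  exact theorem1_general P fun i => (hx i).1.trans (hx i).2
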